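/- Let $T>0$, let $B$ be a standard Brownian motion on $[0,T]$ on a probability space $(\Omega,\mathcal F,P)$, and let $(\mathcal F_t)_{0\le t\le T}$ be the filtration generated by $B$ (augmented by the null events and made right-continuous). Let $f:\mathbb R\to(1,4)$ be smooth with $f'>0$ on $(-\infty,0)$, $f'<0$ on $(0,\infty)$, $f(0)>3$, $\lim_{c\to\pm\infty}f(c)=1$ and $\gamma=\int f(B(T))\,dP<2$. *The economy.* Commodity bundles are pairs $\hat x=(x_0,x)\in\mathbb R\times L^2(P)$ of consumption at dates $0$ and $T$. There are two consumers with consumption set $\mathbb R_+\times L^2_+$, endowments $(1,f(B(T)))$ and $(3,4-f(B(T)))$, and the same utility $U(x_0,x)=u(x_0)+\int u(x)\,dP$, where $u:\mathbb R\to\mathbb R$ is smooth, strictly increasing and strictly concave. A Walrasian equilibrium consists of a price $\hat p=(p_0,p)\in\mathbb R_{++}\times L^2_{++}$ and consumptions $\hat x^1,\hat x^2$ in the consumption set such that, with $\hat p\cdot\hat x=p_0x_0+\int px\,dP$ and $\hat e^i$ the endowments: $\hat p\cdot\hat x^i\le\hat p\cdot\hat e^i$; every $\hat y$ in the consumption set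 with $U(\hat y)>U(\hat x^i)$ has $\hat p\cdot\hat y>\hat p\cdot\hat x^i$; and $\hat x^1+\hat x^2=\hat e^1+\hat e^2$. *Assets and strategies.* There are two assets with dividends $A_0\equiv1$ and $A_1=g(B(T))$ at date $T$, where $g:\mathbb R\to(0,1)$ is smooth and strictly increasing with $\lim_{c\to-\infty}g(c)=0$ and $\lim_{c\to+\infty}g(c)=1$. A trading strategy $\theta=(\theta_0,\theta_1):[0,T]\times\Omega\to\mathbb R^2$ is simple if there are times $0=t_0<t_1<\dots<t_N=T$ and bounded $\mathcal F_{t_i}$-measurable functions $h_{i0},h_{i1}$ with $\theta(t)=(h_{i0},h_{i1})$ for $t\in(t_i,t_{i+1}]$. Write $\operatorname{div}\theta(T)=\theta_0(T)A_0+\theta_1(T)A_1$. The strategy respects consumer 1's terminal wealth constraint if $\operatorname{div}\theta(T)+f(B(T))\ge0$ almost surely, and supports the net trade $\zeta$ if $\operatorname{div}\theta(T)=\zeta$ almost surely. *Claim.* There is a function $\varepsilon:\mathbb R\to\mathbb R$, positive on $(-\infty,2)$ and depending only on $f$ and on the Brownian motion $B$ (in particular not on $u$ or $g$), such that for every $u$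 as above there is a constant $a<2$ with the following properties. 1. The economy has a Walrasian equilibrium, unique up to multiplying the price by a positive constant: $(\hat p,\hat x^1,\hat x^2)$ is a Walrasian equilibrium if and only if $\hat p=(k,k)$ for some constant $k>0$, $\hat x^1=(a,a)$ and $\hat x^2=(4-a,4-a)$ (almost surely). So consumer 1's Walrasian net trade at date $T$ is $z=a-f(B(T))$. 2. For every $g$ as above there are no time $t^*<T$, finite $\mathcal F_{t^*}$-measurable partition $(X_\ell)$ of $\Omega$ and real coefficients $\alpha_{j\ell}$ ($j=0,1$) with $$\sum_{j,\ell}\alpha_{j\ell}\mathbf 1_{X_\ell}A_j+f(B(T))\ge0\ \text{ a.s.}\qquad\text{and}\qquad \Big\|z-\sum_{j,\ell}\alpha_{j\ell}\mathbf 1_{X_\ell}A_j\Big\|_{L^2(P)}<\varepsilon(a).$$ 3. For every $g$ as above there is no sequence (or net) of simple strategies that respect consumer 1's terminal wealth constraint and support net trades converging weakly in $L^2(P)$ to $z$. -/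

import Mathlib

open MeasureTheory ProbabilityTheory Filter Topology
open scoped NNReal ENNReal

namespace SimpleTrading

noncomputable section

/-! ### Time and information -/

/-- The time interval `[0, T]`. -/
abbrev TimeInterval (T : ℝ≥0) : Type := Set.Icc (0 : ℝ≥0) T

/-- The initial date `0`. -/
def initialDate (T : ℝ≥0) : TimeInterval T := ⟨0, le_rfl, zero_le⟩

/-- The terminal date `T`. -/
def terminalDate (T : ℝ≥0) : TimeInterval T := ⟨T, zero_le, le_rfl⟩

/-- `B` is a standard Brownian motion on the time interval `[0, T]`: a family of random variables
that starts at `0`, has independent increments, `B t - B s` is normal with mean `0` and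
variance `t - s` for `s ≤ t`, and the paths are continuous on `[0, T]`. -/
structure IsBrownianMotion {Ω : Type*} [MeasurableSpace Ω] {T : ℝ≥0}
    (B : TimeInterval T → Ω → ℝ) (P : Measure Ω) : Prop where
  measurable : ∀ t, Measurable (B t)
  start : ∀ᵐ ω ∂P, B (initialDate T) ω = 0
  indep_increments : HasIndepIncrements B P
  law_increment : ∀ s t : TimeInterval T, s ≤ t →
    HasLaw (fun ω => B t ω - B s ω) (gaussianReal 0 ((t : ℝ≥0) - (s : ℝ≥0))) P
  continuous_paths : ∀ᵐ ω ∂P, Continuous fun t => B t ω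

/-- The σ-algebra generated by the `P`-null events. -/
abbrev nullAlgebra {Ω : Type*} [MeasurableSpace Ω] (P : Measure Ω) : MeasurableSpace Ω :=
  MeasurableSpace.generateFrom {s | MeasurableSet s ∧ P s = 0}

theorem nullAlgebra_le {Ω : Type*} [m : MeasurableSpace Ω] (P : Measure Ω) :
    nullAlgebra P ≤ m :=
  MeasurableSpace.generateFrom_le fun _ hs => hs.1

/-- The information filtration generated by a process `B` on `[0, T]`, made to satisfy the usual
conditions: the σ-algebras `σ(B s : s ≤ t)` are enlarged by the null events and then replaced
by their right limits (at the terminal date there is no right limit to take). -/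
def informationFiltration {Ω : Type*} [m : MeasurableSpace Ω] {T : ℝ≥0}
    (B : TimeInterval T → Ω → ℝ) (hB : ∀ t, Measurable (B t)) (P : Measure Ω) :
    Filtration (TimeInterval T) m :=
  (Filtration.natural B (fun t => (hB t).stronglyMeasurable) ⊔
    Filtration.const (TimeInterval T) (nullAlgebra P) (nullAlgebra_le P)).rightCont

/-! ### The static economy -/

/-- A pair `(x₀, x)`: certain consumption at date `0` and random consumption at the terminal
date. The same type serves for prices `(p₀, p)`. Random variables are identified when they
agree almost surely. -/
abbrev Bundle (Ω : Type*) : Type _ := ℝ × (Ω → ℝ)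

/-- Almost sure equality of bundles. -/
def Bundle.AEEq {Ω : Type*} [MeasurableSpace Ω] (P : Measure Ω) (x y : Bundle Ω) : Prop :=
  x.1 = y.1 ∧ x.2 =ᵐ[P] y.2

/-- The consumption set `ℝ₊ × L²₊`. -/
def consumptionSet {Ω : Type*} [MeasurableSpace Ω] (P : Measure Ω) : Set (Bundle Ω) :=
  {x | 0 ≤ x.1 ∧ MemLp x.2 2 P ∧ ∀ᵐ ω ∂P, 0 ≤ x.2 ω}

/-- The set `ℝ₊₊ × L²₊₊` of strictly positive prices. -/
def priceSet {Ω : Type*} [MeasurableSpace Ω] (P : Measure Ω) : Set (Bundle Ω) :=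
  {p | 0 < p.1 ∧ MemLp p.2 2 P ∧ ∀ᵐ ω ∂P, 0 < p.2 ω}

/-- The value `p₀ x₀ + ∫ p x dP` of the bundle `x` at the price `p`. -/
def value {Ω : Type*} [MeasurableSpace Ω] (P : Measure Ω) (p x : Bundle Ω) : ℝ :=
  p.1 * x.1 + ∫ ω, p.2 ω * x.2 ω ∂P

/-- A felicity function: smooth, strictly increasing and strictly concave. -/
structure IsFelicity (u : ℝ → ℝ) : Prop where
  smooth : ContDiff ℝ (⊤ : ℕ∞) u
  strictMono : StrictMono u
  strictConcave : StrictConcaveOn ℝ Set.univ u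

/-- Expected utility `u(x₀) + ∫ u(x) dP`. On the consumption set, the integrand is integrable:
by concavity and monotonicity, `u(x)` lies between `u(0)` and an affine function of `x`. -/
def expectedUtility {Ω : Type*} [MeasurableSpace Ω] (P : Measure Ω) (u : ℝ → ℝ)
    (x : Bundle Ω) : ℝ :=
  u x.1 + ∫ ω, u (x.2 ω) ∂P

/-- The price `p` and the consumptions `x i` form a Walrasian (Arrow-Debreu) equilibrium of the
economy in which consumer `i` has endowment `e i` and utility function `U i`. -/
structure IsWalrasianEquilibrium {Ω I : Type*} [MeasurableSpace Ω] [Fintype I] (P : Measure Ω)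
    (e : I → Bundle Ω) (U : I → Bundle Ω → ℝ) (p : Bundle Ω) (x : I → Bundle Ω) : Prop where
  price_mem : p ∈ priceSet P
  consumption_mem : ∀ i, x i ∈ consumptionSet P
  budget : ∀ i, value P p (x i) ≤ value P p (e i)
  optimal : ∀ i, ∀ y ∈ consumptionSet P, U i (x i) < U i y → value P p (x i) < value P p y
  market_clearing : Bundle.AEEq P (∑ i, x i) (∑ i, e i)

/-! ### Assets and simple strategies -/

/-- The dividend of the (random) portfolio `φ` of the assets `A j`. -/
def dividend {Ω J : Type*} [Fintype J] (A : J → Ω → ℝ) (φ : Ω → J → ℝ) (ω : Ω) : ℝ :=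
  ∑ j, φ ω j * A j ω

/-- The trading strategy `θ` is simple: there are finitely many times `0 = τ₀ < ⋯ < τ_N = T` and
bounded `ℱ (τ i)`-measurable portfolios `h i` such that `θ t = h i` for `t ∈ (τ i, τ (i+1)]`. -/
def IsSimpleStrategy {Ω J : Type*} {m : MeasurableSpace Ω} {T : ℝ≥0}
    (ℱ : Filtration (TimeInterval T) m) (θ : TimeInterval T → Ω → J → ℝ) : Prop :=
  ∃ (N : ℕ) (τ : Fin (N + 1) → TimeInterval T) (h : Fin N → Ω → J → ℝ),
    StrictMono τ ∧ τ 0 = initialDate T ∧ τ (Fin.last N) = terminalDate T ∧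
    (∀ i j, Measurable[ℱ (τ i.castSucc)] fun ω => h i ω j) ∧
    (∀ i j, ∃ C : ℝ, ∀ ω, |h i ω j| ≤ C) ∧
    ∀ (i : Fin N) (t : TimeInterval T), τ i.castSucc < t → t ≤ τ i.succ → θ t = h i

/-- `θ` respects the terminal wealth constraint of a consumer with terminal endowment `e`. -/
def RespectsTerminalWealth {Ω J : Type*} [MeasurableSpace Ω] [Fintype J] {T : ℝ≥0}
    (P : Measure Ω) (A : J → Ω → ℝ) (e : Ω → ℝ) (θ : TimeInterval T → Ω → J → ℝ) : Prop :=
  ∀ᵐ ω ∂P, 0 ≤ dividend A (θ (terminalDate T)) ω + e ω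

/-- `θ` supports the net trade `z`: its terminal dividend is `z`. -/
def SupportsNetTrade {Ω J : Type*} [MeasurableSpace Ω] [Fintype J] {T : ℝ≥0}
    (P : Measure Ω) (A : J → Ω → ℝ) (θ : TimeInterval T → Ω → J → ℝ) (z : Ω → ℝ) : Prop :=
  dividend A (θ (terminalDate T)) =ᵐ[P] z

/-- Weak convergence in `L²(P)`, along the filter `l`, of the family `zn` to `z`. -/
def ConvergesWeakly {Ω ι : Type*} [MeasurableSpace Ω] (P : Measure Ω) (l : Filter ι)
    (zn : ι → Ω → ℝ) (z : Ω → ℝ) : Prop :=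
  (∀ n, MemLp (zn n) 2 P) ∧ MemLp z 2 P ∧
    ∀ φ : Ω → ℝ, MemLp φ 2 P →
      Tendsto (fun n => ∫ ω, (zn n ω - z ω) * φ ω ∂P) l (𝓝 0)

/-- The payoff `∑ α_{jℓ} 1_{X_ℓ} A_j`. -/
def stepPayoff {Ω J : Type*} [Fintype J] {L : ℕ} (A : J → Ω → ℝ) (X : Fin L → Set Ω)
    (α : J → Fin L → ℝ) (ω : Ω) : ℝ :=
  ∑ ℓ, ∑ j, (X ℓ).indicator (fun ω' => α j ℓ * A j ω') ω

/-- For the given `ε` there are a time `t < T`, a finite `ℱ t`-measurable partition `X` of the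
state space and coefficients `α` such that `Ψ = ∑ α_{jℓ} 1_{X_ℓ} A_j` satisfies `Ψ + e ≥ 0`
almost surely and `‖z - Ψ‖ < ε` in `L²(P)`. -/
def HasFeasibleStepApproximation {Ω J : Type*} {m : MeasurableSpace Ω} [Fintype J] {T : ℝ≥0}
    (P : Measure Ω) (ℱ : Filtration (TimeInterval T) m) (A : J → Ω → ℝ) (e z : Ω → ℝ)
    (ε : ℝ) : Prop :=
  ∃ t : TimeInterval T, t < terminalDate T ∧
    ∃ (L : ℕ) (X : Fin L → Set Ω) (α : J → Fin L → ℝ),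
      (∀ ℓ, MeasurableSet[ℱ t] (X ℓ)) ∧
      Pairwise (fun k ℓ => Disjoint (X k) (X ℓ)) ∧ (⋃ ℓ, X ℓ) = Set.univ ∧
      (∀ᵐ ω ∂P, 0 ≤ stepPayoff A X α ω + e ω) ∧
      eLpNorm (fun ω => z ω - stepPayoff A X α ω) 2 P < ENNReal.ofReal ε

/-! ### The two-consumer economy and its assets -/

/-- The function of the terminal Brownian value that gives consumer 1's terminal endowment.
The other consumer has `4 - f`, so the values of `f` are below `4`. -/
structure IsEndowmentProfile (f : ℝ → ℝ) : Prop where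
  smooth : ContDiff ℝ (⊤ : ℕ∞) f
  mem_Ioo : ∀ c, f c ∈ Set.Ioo (1 : ℝ) 4
  deriv_pos : ∀ c < 0, 0 < deriv f c
  deriv_neg : ∀ c > 0, deriv f c < 0
  three_lt : 3 < f 0
  tendsto_atBot : Tendsto f atBot (𝓝 1)
  tendsto_atTop : Tendsto f atTop (𝓝 1)

/-- The function of the terminal Brownian value that gives the dividends of the risky asset. -/
structure IsDividendProfile (g : ℝ → ℝ) : Prop where
  smooth : ContDiff ℝ (⊤ : ℕ∞) g
  strictMono : StrictMono g
  mem_Ioo : ∀ c, g c ∈ Set.Ioo (0 : ℝ) 1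
  tendsto_atBot : Tendsto g atBot (𝓝 0)
  tendsto_atTop : Tendsto g atTop (𝓝 1)

/-- The endowments `(1, f(B(T)))` and `(3, 4 - f(B(T)))` of consumers 1 and 2, who are indexed
by `0` and `1`. -/
def endowment {Ω : Type*} {T : ℝ≥0} (B : TimeInterval T → Ω → ℝ) (f : ℝ → ℝ) :
    Fin 2 → Bundle Ω :=
  ![(1, fun ω => f (B (terminalDate T) ω)), (3, fun ω => 4 - f (B (terminalDate T) ω))]

/-- The riskless asset `1` and the risky asset `g(B(T))`. -/
def assets {Ω : Type*} {T : ℝ≥0} (B : TimeInterval T → Ω → ℝ) (g : ℝ → ℝ) :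
    Fin 2 → Ω → ℝ :=
  ![fun _ => 1, fun ω => g (B (terminalDate T) ω)]

/-- The bundle `(c, c)` with the same constant consumption at both dates. -/
def constBundle (Ω : Type*) (c : ℝ) : Bundle Ω := (c, fun _ => c)

end

end SimpleTrading

open SimpleTrading

/-! Constant aggregate consumption forces constant equilibrium prices: replacing each bundle by its
average over dates and states keeps the markets cleared and, by Jensen, can only raise utility. So
each consumer eats the constant average of the own endowment, and a = (1 + γ)/2 < 2
(`isWalrasianEquilibrium_iff`). The obstruction to trading is `neg_one_le_dividend`. A portfolio
fixed before T faces a Gaussian increment of full support, so nonnegative terminal wealth at almost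
every state forces φ₀ + φ₁ g(c) + f(c) ≥ 0 for every real c. Letting c → ±∞, where f → 1, gives φ₀ ≥
-1 and φ₀ + φ₁ ≥ -1; since 0 < g < 1, the dividend is a convex combination of these and is at least
-1 everywhere. But z = a - f(B(T)) is below -1 with positive probability, as f(0) > 3 > a + 1. The
shortfall `endowmentExcess`, the positive part of -1 - z, has positive norm: this norm serves as
ε(a), and testing against the shortfall rules out weak limits. -/

namespace SimpleTrading

/-! ### Information before the terminal date -/

section Information

variable {Ω : Type*} [m : MeasurableSpace Ω] {P : Measure Ω}

/-- Enlarging a σ-algebra by null events preserves independence. -/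
theorem indep_sup_nullAlgebra {Ω : Type*} {m₁ m₂ : MeasurableSpace Ω} [MeasurableSpace Ω]
    {P : Measure Ω} (h : Indep m₁ m₂ P) :
    Indep (m₁ ⊔ nullAlgebra P) m₂ P := by
  -- Each event of the enlarged σ-algebra agrees almost surely with one of `m₁`, and the product
  -- formula sees only measures.
  have hle : m₁ ⊔ nullAlgebra P ≤ eventuallyMeasurableSpace m₁ (ae P) := by
    refine sup_le (le_eventuallyMeasurableSpace (m := m₁)) ?_
    refine MeasurableSpace.generateFrom_le fun s hs => ?_
    exact ⟨∅, @MeasurableSet.empty _ m₁, (ae_eq_empty (μ := P)).2 hs.2⟩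
  rw [Indep_iff] at h ⊢
  intro s t hs ht
  obtain ⟨s', hs', hss'⟩ := hle s hs
  rw [measure_congr (μ := P) hss', ← h s' t hs' ht]
  exact measure_congr (μ := P) (hss'.inter (EventuallyEq.refl _ _))

variable {T : ℝ≥0} {B : TimeInterval T → Ω → ℝ}

theorem IsBrownianMotion.hasGaussianLaw_increment (hB : IsBrownianMotion B P)
    {s t : TimeInterval T} (hst : s ≤ t) : HasGaussianLaw (fun ω => B t ω - B s ω) P :=
  (hB.law_increment s t hst).hasGaussianLaw

theorem IsBrownianMotion.isGaussianProcess (hB : IsBrownianMotion B P) :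
    IsGaussianProcess B P := by
  let _ : OrderBot (TimeInterval T) := { bot := initialDate T, bot_le := fun t => t.2.1 }
  refine HasIndepIncrements.isGaussianProcess (fun t => ?_) hB.start hB.indep_increments
  refine (hB.hasGaussianLaw_increment (s := initialDate T) (t := t) t.2.1).congr ?_
  filter_upwards [hB.start] with ω hω
  simp [hω]

theorem IsBrownianMotion.indepFun_eval_increment (hB : IsBrownianMotion B P)
    {r s t : TimeInterval T} (hrs : r ≤ s) (hst : s ≤ t) :
    IndepFun (B r) (fun ω => B t ω - B s ω) P := by
  -- Along 0, r, s, t, t, …, the increments numbered 0 and 2 are almost surely `B r` and exactly `B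
  -- t - B s`.
  let τ : ℕ → TimeInterval T
    | 0 => initialDate T
    | 1 => r
    | 2 => s
    | _ => t
  have h0 : initialDate T ≤ r := r.2.1
  have hτ : Monotone τ := monotone_nat_of_le_succ fun n => by
    match n with
    | 0 => exact h0
    | 1 => exact hrs
    | 2 => exact hst
    | _ + 3 => exact le_rfl
  refine ((hB.indep_increments.nat hτ).indepFun (by decide : (0 : ℕ) ≠ 2)).congr ?_ .rfl
  filter_upwards [hB.start] with ω hω
  simp [τ, hω]

/-- The past up to s and the later increment are jointly Gaussian, so independence from the whole
past reduces to zero covariance with each single `B r`. -/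
theorem IsBrownianMotion.indep_natural_increment (hB : IsBrownianMotion B P)
    {s t : TimeInterval T} (hst : s ≤ t) :
    Indep (Filtration.natural B (fun t => (hB.measurable t).stronglyMeasurable) s)
      (MeasurableSpace.comap (fun ω => B t ω - B s ω) inferInstance) P := by
  have hG := hB.isGaussianProcess
  have hXY : IsGaussianProcess
      (Sum.elim (fun r : Set.Iic s => B r) (fun (_ : Unit) ω => B t ω - B s ω)) P := by
    classical
    refine hG.of_isGaussianProcess fun i => ?_
    rcases i with r | _
    · exact ⟨{(r : TimeInterval T)},
        { toFun x := x ⟨r, by simp⟩, map_add' := by simp, map_smul' := by simp }, by simp⟩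
    · exact ⟨{t, s},
        { toFun x := x ⟨t, by simp⟩ - x ⟨s, by simp⟩
          map_add' x y := by simp; abel
          map_smul' c x := by simp; ring
          cont := by fun_prop }, by simp⟩
  have hind := hXY.indepFun_of_covariance_eq_zero
    (fun r => (hB.measurable r).aemeasurable)
    (fun _ => ((hB.measurable t).sub (hB.measurable s)).aemeasurable)
    (fun r _ => (hB.indepFun_eval_increment r.2 hst).covariance_eq_zero
      (hG.hasGaussianLaw_eval _).memLp_two (hB.hasGaussianLaw_increment hst).memLp_two)
  have h2 := hind.comp (φ := id) (ψ := fun y : Unit → ℝ => y ()) measurable_id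
    (measurable_pi_apply (X := fun _ => ℝ) ())
  rw [Filtration.natural_eq_comap]
  exact h2

/-- The σ-algebras of the information filtration before time `s` are generated, up to null
events, by `B` on `[0, s]`. -/
theorem informationFiltration_le {hm : ∀ t, Measurable (B t)} {t s : TimeInterval T}
    (hts : t < s) :
    informationFiltration B hm P t ≤
      Filtration.natural B (fun t => (hm t).stronglyMeasurable) s ⊔ nullAlgebra P := by
  have : DenselyOrdered (TimeInterval T) := Set.instDenselyOrdered
  -- Before the last date the right limit is an infimum over later times, and s is one of them.
  rw [informationFiltration, Filtration.rightCont_eq_of_not_isMax _ (not_isMax_iff.2 ⟨s, hts⟩)]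
  exact iInf₂_le s hts

theorem exists_between_terminalDate {t : TimeInterval T} (ht : t < terminalDate T) :
    ∃ s, t < s ∧ s < terminalDate T :=
  have : DenselyOrdered (TimeInterval T) := Set.instDenselyOrdered
  exists_between ht

/-- A portfolio chosen before the terminal date whose dividend plus the endowment is almost surely
nonnegative has almost surely dividend at least `-1`. -/
theorem neg_one_le_dividend [IsProbabilityMeasure P]
    (hB : IsBrownianMotion B P) {f g : ℝ → ℝ} (hf : IsEndowmentProfile f)
    (hg : IsDividendProfile g) {t : TimeInterval T} (ht : t < terminalDate T) {φ₀ φ₁ : Ω → ℝ}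
    (h₀ : Measurable[informationFiltration B hB.measurable P t] φ₀)
    (h₁ : Measurable[informationFiltration B hB.measurable P t] φ₁)
    (h : ∀ᵐ ω ∂P, 0 ≤ φ₀ ω + φ₁ ω * g (B (terminalDate T) ω) + f (B (terminalDate T) ω)) :
    ∀ᵐ ω ∂P, -1 ≤ φ₀ ω + φ₁ ω * g (B (terminalDate T) ω) := by
  obtain ⟨s, hts, hsT⟩ := exists_between_terminalDate ht
  have hle := informationFiltration_le (P := P) (hm := hB.measurable) hts
  have hBs : Measurable[Filtration.natural B (fun t => (hB.measurable t).stronglyMeasurable) s]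
      (B s) :=
    (Filtration.stronglyAdapted_natural (fun t => (hB.measurable t).stronglyMeasurable)
      s).measurable
  -- `Y` is known by time s, `X` is independent of it, and B(T) is the last entry of `Y` plus `X`.
  -- The time s strictly after t absorbs the right limit in the filtration.
  let Y : Ω → ℝ × ℝ × ℝ := fun ω => (φ₀ ω, φ₁ ω, B s ω)
  let X : Ω → ℝ := fun ω => B (terminalDate T) ω - B s ω
  have hY : Measurable[Filtration.natural B (fun t => (hB.measurable t).stronglyMeasurable) s ⊔
      nullAlgebra P] Y :=
    (h₀.mono hle le_rfl).prodMk ((h₁.mono hle le_rfl).prodMk (hBs.mono le_sup_left le_rfl))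
  have hYm : Measurable Y := hY.mono (sup_le (Filtration.le _ s) (nullAlgebra_le P)) le_rfl
  have hXm : Measurable X := (hB.measurable _).sub (hB.measurable s)
  have hind : IndepFun Y X P :=
    indep_of_indep_of_le_left (indep_sup_nullAlgebra (hB.indep_natural_increment hsT.le))
      hY.comap_le
  have hfc : Continuous f := hf.smooth.continuous
  have hgc : Continuous g := hg.smooth.continuous
  let S : Set ((ℝ × ℝ × ℝ) × ℝ) :=
    {q | 0 ≤ q.1.1 + q.1.2.1 * g (q.1.2.2 + q.2) + f (q.1.2.2 + q.2)}
  have hS : IsClosed S := isClosed_le continuous_const (by fun_prop)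
  have hprod : ∀ᵐ q ∂((P.map Y).prod (P.map X)), q ∈ S := by
    rw [← (indepFun_iff_map_prod_eq_prod_map_map hYm.aemeasurable hXm.aemeasurable).1 hind]
    refine (ae_map_iff (hYm.prodMk hXm).aemeasurable hS.measurableSet).2 ?_
    filter_upwards [h] with ω hω
    simpa [S, Y, X] using hω
  have hv : (terminalDate T : ℝ≥0) - (s : ℝ≥0) ≠ 0 :=
    (tsub_pos_of_lt (α := ℝ≥0) hsT).ne'
  have hac : (volume : Measure ℝ) ≪ P.map X := by
    rw [(hB.law_increment s _ hsT.le).map_eq]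
    exact gaussianReal_absolutelyContinuous' 0 hv
  have h3 := ae_of_ae_map hYm.aemeasurable (Measure.ae_ae_of_ae_prod hprod)
  filter_upwards [h3] with ω hω
  -- With `Y ω` frozen, the admissible increments form a closed set of full Lebesgue measure, hence
  -- the whole line.
  have hall : ∀ c, 0 ≤ φ₀ ω + φ₁ ω * g c + f c := by
    have hcl : IsClosed {x | (Y ω, x) ∈ S} := hS.preimage (by fun_prop)
    have hd : Dense {x | (Y ω, x) ∈ S} := Measure.dense_of_ae (hac.ae_le hω)
    intro c
    have hc : c - B s ω ∈ {x | (Y ω, x) ∈ S} := by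
      rw [← hcl.closure_eq]; exact hd _
    simpa [S, Y] using hc
  have hbot : 0 ≤ φ₀ ω + φ₁ ω * 0 + 1 :=
    ge_of_tendsto' (((hg.tendsto_atBot.const_mul _).const_add _).add hf.tendsto_atBot) hall
  have htop : 0 ≤ φ₀ ω + φ₁ ω * 1 + 1 :=
    ge_of_tendsto' (((hg.tendsto_atTop.const_mul _).const_add _).add hf.tendsto_atTop) hall
  obtain ⟨hg0, hg1⟩ := hg.mem_Ioo (B (terminalDate T) ω)
  nlinarith

/-- The terminal endowment exceeds any level below `f 0` with positive probability. -/
theorem measure_lt_endowment_pos (hB : IsBrownianMotion B P) (hT : 0 < T) {f : ℝ → ℝ}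
    (hf : Continuous f) {b : ℝ} (hb : b < f 0) :
    0 < P {ω | b < f (B (terminalDate T) ω)} := by
  have h0T : initialDate T ≤ terminalDate T := (terminalDate T).2.1
  have hlaw := hB.law_increment (initialDate T) (terminalDate T) h0T
  have hXm : Measurable fun ω => B (terminalDate T) ω - B (initialDate T) ω :=
    (hB.measurable _).sub (hB.measurable _)
  have hopen : IsOpen {x | b < f x} := isOpen_lt continuous_const hf
  have hv : (terminalDate T : ℝ≥0) - (initialDate T : ℝ≥0) ≠ 0 := by
    simpa [terminalDate, initialDate] using hT.ne'
  -- The law is given for increments and B starts at 0 only almost surely, so B(T) is first replaced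
  -- by B(T) - B(0).
  have hae : {ω | b < f (B (terminalDate T) ω)} =ᵐ[P]
      (fun ω => B (terminalDate T) ω - B (initialDate T) ω) ⁻¹' {x | b < f x} := by
    filter_upwards [hB.start] with ω hω
    apply propext
    change b < f (B (terminalDate T) ω) ↔
      b < f (B (terminalDate T) ω - B (initialDate T) ω)
    simp [hω]
  rw [measure_congr hae, ← Measure.map_apply hXm hopen.measurableSet, hlaw.map_eq]
  refine pos_iff_ne_zero.2 fun hz => ?_
  exact (hopen.measure_pos volume ⟨0, hb⟩).ne' (gaussianReal_absolutelyContinuous' 0 hv hz)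

end Information

/-! ### Felicity functions and expected utility -/

namespace IsFelicity

variable {u : ℝ → ℝ}

theorem hasDerivAt (hu : IsFelicity u) (c : ℝ) : HasDerivAt u (deriv u c) c :=
  (hu.smooth.differentiable (by simp)).differentiableAt.hasDerivAt

theorem lt_tangent (hu : IsFelicity u) {c y : ℝ} (hy : y ≠ c) :
    u y < u c + deriv u c * (y - c) := by
  rcases lt_or_gt_of_ne hy with h | h
  · have := hu.strictConcave.lt_slope_of_hasDerivAt (Set.mem_univ _) (Set.mem_univ _) h
      (hu.hasDerivAt c)
    rw [slope_def_field, lt_div_iff₀ (sub_pos.2 h)] at this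
    linarith
  · have := hu.strictConcave.slope_lt_of_hasDerivAt (Set.mem_univ _) (Set.mem_univ _) h
      (hu.hasDerivAt c)
    rw [slope_def_field, div_lt_iff₀ (sub_pos.2 h)] at this
    linarith

theorem le_tangent (hu : IsFelicity u) (c y : ℝ) : u y ≤ u c + deriv u c * (y - c) := by
  rcases eq_or_ne y c with rfl | h
  · simp
  · exact (hu.lt_tangent h).le

/-- Strict monotonicity alone would allow a zero derivative; strict concavity puts u(c + 1) > u(c)
below the tangent at c. -/
theorem deriv_pos (hu : IsFelicity u) (c : ℝ) : 0 < deriv u c := by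
  have h1 := hu.lt_tangent (c := c) (y := c + 1) (by simp)
  have h2 := hu.strictMono (lt_add_one c)
  linarith

end IsFelicity

section Utility

variable {Ω : Type*} [MeasurableSpace Ω] {P : Measure Ω} [IsProbabilityMeasure P] {u : ℝ → ℝ}

theorem IsFelicity.integrable_comp (hu : IsFelicity u) {x : Ω → ℝ} (hx : Integrable x P)
    (h0 : ∀ᵐ ω ∂P, 0 ≤ x ω) : Integrable (fun ω => u (x ω)) P := by
  refine integrable_of_le_of_le (g₁ := fun _ => u 0) (g₂ := fun ω => u 0 + deriv u 0 * (x ω - 0))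
    (hu.smooth.continuous.comp_aestronglyMeasurable hx.aestronglyMeasurable) ?_ ?_
    (integrable_const _) (by fun_prop)
  · filter_upwards [h0] with ω hω using hu.strictMono.monotone hω
  · exact ae_of_all _ fun ω => hu.le_tangent 0 (x ω)

/-- The average consumption over the two dates. -/
noncomputable def meanConsumption (P : Measure Ω) (x : Bundle Ω) : ℝ :=
  (x.1 + ∫ ω, x.2 ω ∂P) / 2

theorem integrable_of_mem_consumptionSet {x : Bundle Ω} (hx : x ∈ consumptionSet P) :
    Integrable x.2 P := hx.2.1.integrable (by norm_num)

omit [IsProbabilityMeasure P] in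
theorem meanConsumption_nonneg {x : Bundle Ω} (hx : x ∈ consumptionSet P) :
    0 ≤ meanConsumption P x :=
  div_nonneg (add_nonneg hx.1 (integral_nonneg_of_ae hx.2.2)) zero_le_two

/-- Expected utility lies below its supporting affine function at a constant bundle. -/
theorem expectedUtility_le_tangent (hu : IsFelicity u) {x : Bundle Ω}
    (hx : x ∈ consumptionSet P) (c : ℝ) :
    expectedUtility P u x ≤ 2 * u c + deriv u c * (2 * (meanConsumption P x - c)) := by
  have hxi := integrable_of_mem_consumptionSet hx
  have h1 := hu.le_tangent c x.1
  have h2 : ∫ ω, u (x.2 ω) ∂P ≤ ∫ ω, (u c + deriv u c * (x.2 ω - c)) ∂P :=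
    integral_mono (hu.integrable_comp hxi hx.2.2) (by fun_prop) fun ω => hu.le_tangent c _
  rw [integral_add (integrable_const _) (by fun_prop), integral_const_mul,
    integral_sub hxi (integrable_const _)] at h2
  simp only [integral_const, probReal_univ, one_smul] at h2
  simp only [expectedUtility, meanConsumption]
  linarith

/-- Only the constant bundle attains the utility of its average consumption. -/
theorem aeeq_constBundle_of_le_expectedUtility (hu : IsFelicity u) {x : Bundle Ω}
    (hx : x ∈ consumptionSet P)
    (h : 2 * u (meanConsumption P x) ≤ expectedUtility P u x) :
    Bundle.AEEq P x (constBundle Ω (meanConsumption P x)) := by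
  set c := meanConsumption P x with hc
  have hxi := integrable_of_mem_consumptionSet hx
  have hui := hu.integrable_comp hxi hx.2.2
  have hti : Integrable (fun ω => u c + deriv u c * (x.2 ω - c)) P := by fun_prop
  have h1 := hu.le_tangent c x.1
  have h2 : ∫ ω, (u c + deriv u c * (x.2 ω - c)) ∂P
      = u c + deriv u c * (∫ ω, x.2 ω ∂P - c) := by
    rw [integral_add (integrable_const _) (by fun_prop), integral_const_mul,
      integral_sub hxi (integrable_const _)]
    simp
  have h3 : ∫ ω, u (x.2 ω) ∂P ≤ ∫ ω, (u c + deriv u c * (x.2 ω - c)) ∂P :=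
    integral_mono hui hti fun ω => hu.le_tangent c _
  have h4 : x.1 + ∫ ω, x.2 ω ∂P = 2 * c := by rw [hc, meanConsumption]; ring
  -- Since c is the average, the linear terms of the two dates cancel. The tangent inequality must
  -- then be an equality at each date.
  have h5 : deriv u c * (x.1 - c) + deriv u c * (∫ ω, x.2 ω ∂P - c) = 0 := by
    rw [← mul_add]
    exact mul_eq_zero_of_right _ (by linarith)
  simp only [expectedUtility] at h
  constructor
  · by_contra hne
    have := hu.lt_tangent (c := c) hne
    linarith
  · have h6 : ∫ ω, (u c + deriv u c * (x.2 ω - c) - u (x.2 ω)) ∂P = 0 := by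
      rw [integral_sub hti hui]
      linarith
    rw [integral_eq_zero_iff_of_nonneg (fun ω => sub_nonneg.2 (hu.le_tangent c _))
      (hti.sub hui)] at h6
    filter_upwards [h6] with ω hω
    by_contra hne
    have := hu.lt_tangent (c := c) hne
    simp only [Pi.zero_apply] at hω
    linarith

omit [IsProbabilityMeasure P] in
theorem expectedUtility_congr {x y : Bundle Ω} (h : Bundle.AEEq P x y) :
    expectedUtility P u x = expectedUtility P u y := by
  simp only [expectedUtility, h.1]
  congr 1
  exact integral_congr_ae (h.2.mono fun ω hω => by simp only [hω])

omit [IsProbabilityMeasure P] in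
theorem value_congr {p q x y : Bundle Ω} (hp : Bundle.AEEq P p q) (h : Bundle.AEEq P x y) :
    value P p x = value P q y := by
  simp only [value, h.1, hp.1]
  congr 1
  refine integral_congr_ae ?_
  filter_upwards [hp.2, h.2] with ω h1 h2
  simp only [h1, h2]

theorem expectedUtility_constBundle (c : ℝ) :
    expectedUtility P u (constBundle Ω c) = 2 * u c := by
  simp [expectedUtility, constBundle, two_mul]

omit [IsProbabilityMeasure P] in
theorem value_constBundle_left {x : Bundle Ω} (k : ℝ) :
    value P (constBundle Ω k) x = k * (2 * meanConsumption P x) := by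
  simp only [value, constBundle, meanConsumption, integral_const_mul]
  ring

omit [IsProbabilityMeasure P] in
theorem value_add {p x y : Bundle Ω} (hp : MemLp p.2 2 P) (hx : MemLp x.2 2 P)
    (hy : MemLp y.2 2 P) : value P p (x + y) = value P p x + value P p y := by
  have h : ∫ ω, p.2 ω * (x + y).2 ω ∂P = ∫ ω, p.2 ω * x.2 ω ∂P + ∫ ω, p.2 ω * y.2 ω ∂P := by
    have hpx : Integrable (fun ω => p.2 ω * x.2 ω) P := hp.integrable_mul hx
    have hpy : Integrable (fun ω => p.2 ω * y.2 ω) P := hp.integrable_mul hy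
    rw [← integral_add hpx hpy]
    exact integral_congr_ae (ae_of_all _ fun ω => by simp [mul_add])
  simp only [value, h, Prod.fst_add]
  ring

theorem constBundle_mem_consumptionSet {c : ℝ} (hc : 0 ≤ c) :
    constBundle Ω c ∈ consumptionSet P :=
  ⟨hc, memLp_const _, ae_of_all _ fun _ => hc⟩

/-- At a price at which `x` is optimal, its average consumption is worth at least as much. -/
theorem value_le_value_meanConsumption (hu : IsFelicity u) {p x : Bundle Ω}
    (hp : p ∈ priceSet P) (hx : x ∈ consumptionSet P)
    (hopt : ∀ y ∈ consumptionSet P, expectedUtility P u x < expectedUtility P u y →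
      value P p x < value P p y) :
    value P p x ≤ value P p (constBundle Ω (meanConsumption P x)) ∧
      (value P p (constBundle Ω (meanConsumption P x)) ≤ value P p x →
        Bundle.AEEq P x (constBundle Ω (meanConsumption P x))) := by
  have hc := meanConsumption_nonneg hx
  have hle := expectedUtility_le_tangent hu hx (meanConsumption P x)
  set c := meanConsumption P x
  have hpp : 0 < p.1 := hp.1
  constructor
  · refine le_of_forall_pos_le_add fun δ hδ => ?_
    -- Extra date-0 consumption worth δ makes the average bundle strictly better than x, so by
    -- optimality it costs more than x.
    have hδp : 0 < δ / p.1 := div_pos hδ hpp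
    have h := hopt (c + δ / p.1, fun _ => c)
      ⟨by positivity, memLp_const _, ae_of_all _ fun _ => hc⟩ (by
        have := hu.strictMono (lt_add_of_pos_right c hδp)
        simp only [expectedUtility, integral_const, probReal_univ, one_smul] at hle ⊢
        linarith)
    refine h.le.trans (le_of_eq ?_)
    simp only [value, constBundle]
    field_simp
    ring
  · intro h
    refine aeeq_constBundle_of_le_expectedUtility hu hx ?_
    by_contra! hlt
    rw [← expectedUtility_constBundle (P := P)] at hlt
    exact (hopt _ (constBundle_mem_consumptionSet hc) hlt).not_ge h

/-- A price supporting a positive constant bundle as an optimal choice is constant. -/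
theorem exists_aeeq_constBundle_of_optimal (hu : IsFelicity u) {p : Bundle Ω} {c : ℝ}
    (hc : 0 < c) (hp : p ∈ priceSet P)
    (hopt : ∀ y ∈ consumptionSet P,
      expectedUtility P u (constBundle Ω c) < expectedUtility P u y →
        value P p (constBundle Ω c) < value P p y) :
    ∃ k > 0, Bundle.AEEq P p (constBundle Ω k) := by
  refine ⟨p.1, hp.1, rfl, ?_⟩
  have hpi : Integrable p.2 P := hp.2.1.integrable (by norm_num)
  -- A variational argument: consumption on A changes by tσ and date-0 consumption by t(δ - σ P(A)),
  -- where δ is worth η. Utility then has slope u'(c)δ > 0, so for small t the change is an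
  -- improvement and must cost more; c > 0 keeps it feasible for either sign of σ. Taking σ = ±1
  -- gives equality.
  have key : ∀ (A : Set Ω), MeasurableSet A → ∀ σ : ℝ,
      0 ≤ σ * (∫ ω in A, p.2 ω ∂P - p.1 * P.real A) := by
    intro A hA σ
    refine le_of_forall_pos_le_add fun η hη => ?_
    set δ := η / p.1 with hδ
    have hδp : 0 < δ := div_pos hη hp.1
    set b := δ - σ * P.real A with hb
    let φ : ℝ → ℝ := fun t => u (c + t * b) + (u c + P.real A * (u (c + t * σ) - u c))
    have hlin : ∀ r : ℝ, HasDerivAt (fun t : ℝ => c + t * r) r 0 := fun r => by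
      simpa using ((hasDerivAt_id (0 : ℝ)).mul_const r).const_add c
    have hd : ∀ r : ℝ, HasDerivAt (fun t : ℝ => u (c + t * r)) (deriv u c * r) 0 := fun r =>
      HasDerivAt.comp (0 : ℝ) (h₂ := u) (by simpa using hu.hasDerivAt c) (hlin r)
    have hφ : HasDerivAt φ (deriv u c * δ) 0 := by
      have h := (hd b).add ((((hd σ).sub_const (u c)).const_mul (P.real A)).const_add (u c))
      refine h.congr_deriv ?_
      rw [hb]; ring
    have hpos : 0 < deriv u c * δ := mul_pos (hu.deriv_pos c) hδp
    have hev : ∀ᶠ t in 𝓝[>] (0 : ℝ), 0 < slope φ 0 t :=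
      (hasDerivAt_iff_tendsto_slope.1 hφ |>.mono_left
        (nhdsWithin_mono _ fun t (ht : 0 < t) => ht.ne')).eventually (lt_mem_nhds hpos)
    have hnn : ∀ r : ℝ, ∀ᶠ t in 𝓝[>] (0 : ℝ), 0 < c + t * r := fun r =>
      ((hlin r).continuousAt.tendsto.mono_left nhdsWithin_le_nhds).eventually
        (lt_mem_nhds (by simpa using hc))
    obtain ⟨t, ht1, ht2, ht3, ht0⟩ :=
      (hev.and ((hnn b).and ((hnn σ).and self_mem_nhdsWithin))).exists
    have ht0 : 0 < t := ht0
    have hφt : φ 0 < φ t := by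
      rw [slope_def_field, sub_zero] at ht1
      have := (div_pos_iff_of_pos_right ht0).1 ht1
      linarith
    let y : Bundle Ω := (c + t * b, fun ω => c + A.indicator (fun _ => t * σ) ω)
    have hy2 : MemLp y.2 2 P := (memLp_const c).add ((memLp_const (t * σ)).indicator hA)
    have hy : y ∈ consumptionSet P := by
      refine ⟨ht2.le, hy2, ae_of_all _ fun ω => ?_⟩
      by_cases hω : ω ∈ A
      · simpa [y, hω] using ht3.le
      · simpa [y, hω] using hc.le
    have hUy : expectedUtility P u y = φ t := by
      have h1 : ∀ ω, u (y.2 ω) = u c + A.indicator (fun _ => u (c + t * σ) - u c) ω := by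
        intro ω
        by_cases hω : ω ∈ A <;> simp [y, hω]
      simp only [expectedUtility, h1]
      rw [integral_add (integrable_const _) ((integrable_const _).indicator hA),
        integral_indicator_const _ hA]
      simp [y, φ]
    have hU0 : expectedUtility P u (constBundle Ω c) = φ 0 := by
      rw [expectedUtility_constBundle]; simp [φ, two_mul]
    have hval := hopt y hy (by rw [hUy, hU0]; exact hφt)
    have hvy : value P p y
        = value P p (constBundle Ω c) + t * (p.1 * b + σ * ∫ ω in A, p.2 ω ∂P) := by
      have h1 : ∀ ω, p.2 ω * y.2 ω = p.2 ω * c + A.indicator p.2 ω * (t * σ) := by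
        intro ω
        by_cases hω : ω ∈ A <;> simp [y, hω, mul_add]
      simp only [value, h1]
      rw [integral_add (hpi.mul_const c) ((hpi.indicator hA).mul_const _), integral_mul_const,
        integral_mul_const, integral_indicator hA]
      simp only [y, constBundle, integral_mul_const]
      ring
    rw [hvy] at hval
    have h2 : 0 < p.1 * b + σ * ∫ ω in A, p.2 ω ∂P :=
      pos_of_mul_pos_right (by linarith) ht0.le
    have h3 : p.1 * b = η - σ * (p.1 * P.real A) := by
      have := hp.1.ne'
      rw [hb, hδ]; field_simp
    rw [h3] at h2
    linarith
  refine hpi.ae_eq_of_forall_setIntegral_eq _ _ (integrable_const _) fun A hA _ => ?_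
  have h1 := key A hA 1
  have h2 := key A hA (-1)
  simp only [constBundle, integral_const, measureReal_restrict_apply_univ, smul_eq_mul]
  linarith

end Utility

/-! ### The Walrasian equilibrium -/

section Equilibrium

variable {Ω : Type*} [MeasurableSpace Ω] {P : Measure Ω}

theorem mem_consumptionSet_of_aeeq {x y : Bundle Ω} (h : Bundle.AEEq P x y)
    (hy : y ∈ consumptionSet P) : x ∈ consumptionSet P := by
  refine ⟨h.1 ▸ hy.1, hy.2.1.ae_eq h.2.symm, ?_⟩
  filter_upwards [h.2, hy.2.2] with ω h1 h2
  rwa [h1]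

theorem meanConsumption_congr {x y : Bundle Ω} (h : Bundle.AEEq P x y) :
    meanConsumption P x = meanConsumption P y := by
  rw [meanConsumption, meanConsumption, h.1, integral_congr_ae h.2]

theorem meanConsumption_add {x y : Bundle Ω} (hx : Integrable x.2 P) (hy : Integrable y.2 P) :
    meanConsumption P (x + y) = meanConsumption P x + meanConsumption P y := by
  simp only [meanConsumption, Prod.fst_add, Prod.snd_add, integral_add' hx hy]
  ring

omit [MeasurableSpace Ω] in
theorem sum_endowment {T : ℝ≥0} (B : TimeInterval T → Ω → ℝ) (f : ℝ → ℝ) :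
    ∑ i, endowment B f i = constBundle Ω 4 := by
  simp only [Fin.sum_univ_two, endowment, constBundle]
  ext
  · norm_num
  · simp

variable [IsProbabilityMeasure P]

theorem meanConsumption_constBundle (c : ℝ) : meanConsumption P (constBundle Ω c) = c := by
  simp [meanConsumption, constBundle]

/-- If the total endowment of two consumers with the same felicity function is the constant
bundle `s`, and the consumers have positive average endowments `c 0`, `c 1`, then the
equilibria are exactly the constant prices with the constant consumptions `c 0` and `c 1`. -/
theorem isWalrasianEquilibrium_iff {u : ℝ → ℝ} (hu : IsFelicity u) {e : Fin 2 → Bundle Ω}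
    {s : ℝ} (hs : ∑ i, e i = constBundle Ω s) {c : Fin 2 → ℝ}
    (hc : ∀ i, 0 < c i) (hmean : ∀ i, meanConsumption P (e i) = c i) (hsum : c 0 + c 1 = s)
    (p : Bundle Ω) (x : Fin 2 → Bundle Ω) :
    IsWalrasianEquilibrium P e (fun _ => expectedUtility P u) p x ↔
      (∃ k > 0, Bundle.AEEq P p (constBundle Ω k)) ∧
        ∀ i, Bundle.AEEq P (x i) (constBundle Ω (c i)) := by
  have hspos : 0 < s := hsum ▸ add_pos (hc 0) (hc 1)
  constructor
  · intro h
    have hmem := h.consumption_mem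
    have hclear := h.market_clearing
    rw [hs, Fin.sum_univ_two] at hclear
    have hopt := fun i => value_le_value_meanConsumption hu h.price_mem (hmem i) (h.optimal i)
    set d : Fin 2 → ℝ := fun i => meanConsumption P (x i) with hd
    have hd0 : ∀ i, 0 ≤ d i := fun i => meanConsumption_nonneg (hmem i)
    have hdsum : d 0 + d 1 = s := by
      rw [hd, ← meanConsumption_add (integrable_of_mem_consumptionSet (hmem 0))
        (integrable_of_mem_consumptionSet (hmem 1)), meanConsumption_congr hclear,
        meanConsumption_constBundle]
    have hvsum : value P p (x 0) + value P p (x 1)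
        = value P p (constBundle Ω (d 0)) + value P p (constBundle Ω (d 1)) := by
      rw [← value_add h.price_mem.2.1 (hmem 0).2.1 (hmem 1).2.1,
        ← value_add h.price_mem.2.1 (memLp_const _) (memLp_const _),
        value_congr ⟨rfl, ae_eq_refl _⟩ hclear, ← hdsum]
      rfl
    -- No bundle is worth more than its average, yet the total values agree by market clearing; so
    -- each inequality is an equality and each bundle is constant.
    have hxd : ∀ i, Bundle.AEEq P (x i) (constBundle Ω (d i)) := by
      have h0 := (hopt 0).1
      have h1 := (hopt 1).1
      refine Fin.forall_fin_two.2 ⟨(hopt 0).2 ?_, (hopt 1).2 ?_⟩ <;> linarith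
    -- One consumer with positive consumption is enough to identify the price.
    obtain ⟨i, hi⟩ : ∃ i, 0 < d i := by
      by_contra! hneg
      linarith [hneg 0, hneg 1]
    obtain ⟨k, hk, hpk⟩ := exists_aeeq_constBundle_of_optimal hu hi h.price_mem
      fun y hy hlt => by
        have := h.optimal i y hy ((expectedUtility_congr (hxd i)).trans_lt hlt)
        rwa [value_congr ⟨rfl, ae_eq_refl _⟩ (hxd i)] at this
    have hbud : ∀ i, d i ≤ c i := by
      intro i
      have := h.budget i
      rw [value_congr hpk (hxd i), value_congr hpk ⟨rfl, ae_eq_refl _⟩,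
        value_constBundle_left, value_constBundle_left, meanConsumption_constBundle,
        hmean] at this
      linarith [le_of_mul_le_mul_left this hk]
    have hdc : ∀ i, d i = c i := by
      have h0 := hbud 0
      have h1 := hbud 1
      refine Fin.forall_fin_two.2 ⟨?_, ?_⟩ <;> linarith
    exact ⟨⟨k, hk, hpk⟩, fun i => hdc i ▸ hxd i⟩
  · rintro ⟨⟨k, hk, hpk⟩, hx⟩
    have hval : ∀ y, value P p y = k * (2 * meanConsumption P y) := fun y => by
      rw [value_congr hpk ⟨rfl, ae_eq_refl _⟩, value_constBundle_left]
    have hxm : ∀ i, meanConsumption P (x i) = c i := fun i => by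
      rw [meanConsumption_congr (hx i), meanConsumption_constBundle]
    refine ⟨⟨hpk.1.symm ▸ hk, (memLp_const k).ae_eq hpk.2.symm, ?_⟩, fun i => ?_, fun i => ?_,
      fun i y hy hlt => ?_, ?_⟩
    · filter_upwards [hpk.2] with ω hω
      rw [hω]; exact hk
    · exact mem_consumptionSet_of_aeeq (hx i) (constBundle_mem_consumptionSet (hc i).le)
    · rw [hval, hval, hxm, hmean]
    · rw [hval, hval, hxm]
      change expectedUtility P u (x i) < expectedUtility P u y at hlt
      rw [expectedUtility_congr (hx i), expectedUtility_constBundle] at hlt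
      -- By the tangent inequality a preferred bundle has a larger average, which is all that a
      -- constant price values.
      have h1 := expectedUtility_le_tangent hu hy (c i)
      have h2 : 0 < deriv u (c i) * (2 * (meanConsumption P y - c i)) := by linarith
      have h3 := (pos_iff_pos_of_mul_pos h2).1 (hu.deriv_pos _)
      exact mul_lt_mul_of_pos_left (by linarith) hk
    · rw [hs, Fin.sum_univ_two]
      refine ⟨?_, ?_⟩
      · rw [Prod.fst_add, (hx 0).1, (hx 1).1]; exact hsum
      · filter_upwards [(hx 0).2, (hx 1).2] with ω h0 h1
        rw [Prod.snd_add, Pi.add_apply, h0, h1]; exact hsum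

end Equilibrium

/-! ### The trading strategies -/

section Trading

variable {Ω : Type*} [MeasurableSpace Ω] {P : Measure Ω} [IsProbabilityMeasure P] {T : ℝ≥0}
  {B : TimeInterval T → Ω → ℝ} {f g : ℝ → ℝ}

theorem neg_one_le_stepPayoff (hB : IsBrownianMotion B P) (hf : IsEndowmentProfile f)
    (hg : IsDividendProfile g) {t : TimeInterval T} (ht : t < terminalDate T) {L : ℕ}
    {X : Fin L → Set Ω} {α : Fin 2 → Fin L → ℝ}
    (hX : ∀ ℓ, MeasurableSet[informationFiltration B hB.measurable P t] (X ℓ))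
    (h : ∀ᵐ ω ∂P, 0 ≤ stepPayoff (assets B g) X α ω + f (B (terminalDate T) ω)) :
    ∀ᵐ ω ∂P, -1 ≤ stepPayoff (assets B g) X α ω := by
  -- Grouped by asset, the step payoff is the dividend of a portfolio known at time t.
  let φ : Fin 2 → Ω → ℝ := fun j ω => ∑ ℓ, (X ℓ).indicator (fun _ => α j ℓ) ω
  have hφ : ∀ j, Measurable[informationFiltration B hB.measurable P t] (φ j) := fun j =>
    Finset.measurable_fun_sum _ fun ℓ _ => measurable_const.indicator (hX ℓ)
  have heq : ∀ ω, stepPayoff (assets B g) X α ω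
      = φ 0 ω + φ 1 ω * g (B (terminalDate T) ω) := by
    intro ω
    simp only [stepPayoff, φ, Finset.sum_mul, ← Finset.sum_add_distrib, Fin.sum_univ_two]
    refine Finset.sum_congr rfl fun ℓ _ => ?_
    by_cases hω : ω ∈ X ℓ <;> simp [hω, assets]
  simp only [heq] at h ⊢
  exact neg_one_le_dividend hB hf hg ht (hφ 0) (hφ 1) h

/-- The terminal dividend depends only on the last portfolio, which is chosen strictly before T. -/
theorem neg_one_le_of_supportsNetTrade (hB : IsBrownianMotion B P) (hT : 0 < T)
    (hf : IsEndowmentProfile f) (hg : IsDividendProfile g)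
    {θ : TimeInterval T → Ω → Fin 2 → ℝ} {z : Ω → ℝ}
    (hθ : IsSimpleStrategy (informationFiltration B hB.measurable P) θ)
    (hw : RespectsTerminalWealth P (assets B g) (fun ω => f (B (terminalDate T) ω)) θ)
    (hz : SupportsNetTrade P (assets B g) θ z) : ∀ᵐ ω ∂P, -1 ≤ z ω := by
  obtain ⟨N, τ, h, hτ, h0, hlast, hmeas, -, hval⟩ := hθ
  -- Without any trading interval, the first and last grid times would coincide, contradicting 0 <
  -- T.
  obtain _ | N := N
  · have : initialDate T = terminalDate T := h0.symm.trans hlast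
    exact absurd (congrArg Subtype.val this) hT.ne
  have hlt : τ (Fin.last N).castSucc < terminalDate T := by
    rw [← hlast]; exact hτ (Fin.castSucc_lt_last _)
  have hθT : θ (terminalDate T) = h (Fin.last N) :=
    hval (Fin.last N) _ hlt (by rw [Fin.succ_last, hlast])
  have heq : ∀ ω, dividend (assets B g) (θ (terminalDate T)) ω
      = h (Fin.last N) ω 0 + h (Fin.last N) ω 1 * g (B (terminalDate T) ω) := by
    intro ω
    simp [dividend, hθT, assets]
  have h1 := neg_one_le_dividend hB hf hg hlt (hmeas (Fin.last N) 0) (hmeas (Fin.last N) 1)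
    (by simpa only [RespectsTerminalWealth, heq] using hw)
  filter_upwards [h1, hz] with ω h2 h3
  rwa [← h3, heq]

/-- The amount by which the terminal endowment exceeds `b + 1`. -/
noncomputable def endowmentExcess (B : TimeInterval T → Ω → ℝ) (f : ℝ → ℝ) (b : ℝ) (ω : Ω) : ℝ :=
  max (f (B (terminalDate T) ω) - b - 1) 0

theorem memLp_endowmentExcess (hB : IsBrownianMotion B P) (hf : IsEndowmentProfile f) (b : ℝ) :
    MemLp (endowmentExcess B f b) 2 P := by
  have hm : Measurable (endowmentExcess B f b) :=
    ((((hf.smooth.continuous.measurable.comp (hB.measurable _)).sub_const b).sub_const 1).max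
      measurable_const)
  refine MemLp.of_bound hm.aestronglyMeasurable (|b| + 3) (ae_of_all _ fun ω => ?_)
  obtain ⟨-, h⟩ := hf.mem_Ioo (B (terminalDate T) ω)
  rw [endowmentExcess, Real.norm_of_nonneg (le_max_right _ _)]
  refine max_le ?_ (by positivity)
  linarith [neg_abs_le b]

omit [IsProbabilityMeasure P] in
theorem not_endowmentExcess_ae_eq_zero (hB : IsBrownianMotion B P) (hT : 0 < T)
    (hf : IsEndowmentProfile f) {b : ℝ} (hb : b < 2) : ¬ endowmentExcess B f b =ᵐ[P] 0 := by
  intro h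
  have hpos := measure_lt_endowment_pos hB hT hf.smooth.continuous (b := b + 1)
    (by linarith [hf.three_lt])
  refine hpos.ne' (measure_mono_null (fun ω hω => ?_) (ae_iff.1 h))
  have : 0 < endowmentExcess B f b ω :=
    lt_max_of_lt_left (by have : b + 1 < _ := hω; linarith)
  exact this.ne'

/-- A payoff that is at least -1 misses b - f(B(T)) pointwise by at least the shortfall, so its L²
distance is at least the norm of the shortfall. -/
theorem not_hasFeasibleStepApproximation (hB : IsBrownianMotion B P) (hf : IsEndowmentProfile f)
    (hg : IsDividendProfile g) (b : ℝ) :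
    ¬ HasFeasibleStepApproximation P (informationFiltration B hB.measurable P) (assets B g)
      (fun ω => f (B (terminalDate T) ω)) (fun ω => b - f (B (terminalDate T) ω))
      (eLpNorm (endowmentExcess B f b) 2 P).toReal := by
  rintro ⟨t, ht, L, X, α, hX, -, -, hfeas, hlt⟩
  rw [ENNReal.ofReal_toReal (memLp_endowmentExcess hB hf b).2.ne] at hlt
  refine hlt.not_ge (eLpNorm_mono_ae ?_)
  filter_upwards [neg_one_le_stepPayoff hB hf hg ht hX hfeas] with ω hω
  rw [endowmentExcess, Real.norm_of_nonneg (le_max_right _ _), Real.norm_eq_abs]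
  refine max_le ?_ (abs_nonneg _)
  refine le_trans ?_ (neg_le_abs _)
  linarith

/-- With the shortfall φ as test function, (zₙ - z)φ ≥ φ²: either φ = 0 or φ = -1 - z ≤ zₙ - z. The
integrals thus stay above ∫ φ² > 0. -/
theorem not_convergesWeakly (hB : IsBrownianMotion B P) (hT : 0 < T)
    (hf : IsEndowmentProfile f) {b : ℝ} (hb : b < 2) {ι : Type*} {l : Filter ι} [l.NeBot]
    {zn : ι → Ω → ℝ} (hzn : ∀ n, ∀ᵐ ω ∂P, -1 ≤ zn n ω) :
    ¬ ConvergesWeakly P l zn fun ω => b - f (B (terminalDate T) ω) := by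
  rintro ⟨hLn, hL, hlim⟩
  have hφ := memLp_endowmentExcess hB hf b
  set φ := endowmentExcess B f b with hφdef
  have hφ2 : Integrable (fun ω => φ ω * φ ω) P := hφ.integrable_mul hφ
  have hle : ∀ n, ∫ ω, φ ω * φ ω ∂P
      ≤ ∫ ω, (zn n ω - (b - f (B (terminalDate T) ω))) * φ ω ∂P := by
    intro n
    have hi : Integrable (fun ω => (zn n ω - (b - f (B (terminalDate T) ω))) * φ ω) P :=
      ((hLn n).sub hL).integrable_mul hφ
    refine integral_mono_ae hφ2 hi ?_
    filter_upwards [hzn n] with ω hω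
    simp only [hφdef, endowmentExcess]
    rcases max_cases (f (B (terminalDate T) ω) - b - 1) 0 with ⟨h1, h2⟩ | ⟨h1, -⟩
    · rw [h1]
      exact mul_le_mul_of_nonneg_right (by linarith) h2
    · simp [h1]
  have h0 : ∫ ω, φ ω * φ ω ∂P ≤ 0 := ge_of_tendsto' (hlim φ hφ) hle
  have h1 := (integral_eq_zero_iff_of_nonneg (fun ω => mul_self_nonneg (φ ω)) hφ2).1
    (h0.antisymm (integral_nonneg fun ω => mul_self_nonneg (φ ω)))
  refine not_endowmentExcess_ae_eq_zero hB hT hf hb ?_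
  filter_upwards [h1] with ω hω
  exact mul_self_eq_zero.1 hω

end Trading

end SimpleTrading

theorem mainTheorem3 {Ω : Type*} [MeasurableSpace Ω] (P : Measure Ω)
    [IsProbabilityMeasure P] (T : ℝ≥0) (hT : 0 < T) (B : TimeInterval T → Ω → ℝ)
    (hB : IsBrownianMotion B P) (f : ℝ → ℝ) (hf : IsEndowmentProfile f)
    (hγ : ∫ ω, f (B (terminalDate T) ω) ∂P < 2) :
    ∃ ε : ℝ → ℝ, (∀ c < 2, 0 < ε c) ∧
      ∀ u : ℝ → ℝ, IsFelicity u → ∃ a < 2,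
        -- up to price normalization, the Walrasian equilibrium exists and is unique
        (∀ (p : Bundle Ω) (x : Fin 2 → Bundle Ω),
          IsWalrasianEquilibrium P (endowment B f) (fun _ => expectedUtility P u) p x ↔
            (∃ k > 0, Bundle.AEEq P p (constBundle Ω k)) ∧
              Bundle.AEEq P (x 0) (constBundle Ω a) ∧
              Bundle.AEEq P (x 1) (constBundle Ω (4 - a))) ∧
        ∀ g : ℝ → ℝ, IsDividendProfile g →
          -- the necessary condition fails for the net trade `a - f(B(T))`
          ¬ HasFeasibleStepApproximation P (informationFiltration B hB.measurable P)
              (assets B g) (fun ω => f (B (terminalDate T) ω))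
              (fun ω => a - f (B (terminalDate T) ω)) (ε a) ∧
          -- no net of simple strategies does what is required
          ∀ (ι : Type*) [Preorder ι] [IsDirectedOrder ι] [Nonempty ι]
            (θ : ι → TimeInterval T → Ω → Fin 2 → ℝ) (zn : ι → Ω → ℝ),
            (∀ n, IsSimpleStrategy (informationFiltration B hB.measurable P) (θ n)) →
            (∀ n, RespectsTerminalWealth P (assets B g)
              (fun ω => f (B (terminalDate T) ω)) (θ n)) →
            (∀ n, SupportsNetTrade P (assets B g) (θ n) (zn n)) →
            ¬ ConvergesWeakly P atTop zn (fun ω => a - f (B (terminalDate T) ω)) := by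
  refine ⟨fun c => (eLpNorm (endowmentExcess B f c) 2 P).toReal, fun c hc => ?_,
    fun u hu => ⟨(1 + ∫ ω, f (B (terminalDate T) ω) ∂P) / 2, by linarith, fun p x => ?_,
      fun g hg => ⟨not_hasFeasibleStepApproximation hB hf hg _,
        fun ι _ _ _ θ zn hθ hw hz => not_convergesWeakly hB hT hf (by linarith) fun n =>
          neg_one_le_of_supportsNetTrade hB hT hf hg (hθ n) (hw n) (hz n)⟩⟩⟩
  · have hL := memLp_endowmentExcess hB hf c
    refine ENNReal.toReal_pos (fun h => ?_) hL.2.ne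
    exact not_endowmentExcess_ae_eq_zero hB hT hf hc
      ((eLpNorm_eq_zero_iff hL.1 two_ne_zero).1 h)
  · set γ := ∫ ω, f (B (terminalDate T) ω) ∂P with hγdef
    have hγ0 : 0 ≤ γ := integral_nonneg fun ω => zero_le_one.trans (hf.mem_Ioo _).1.le
    have hint : Integrable (fun ω => f (B (terminalDate T) ω)) P :=
      Integrable.of_bound
        (hf.smooth.continuous.measurable.comp (hB.measurable _)).aestronglyMeasurable 4
        (ae_of_all _ fun ω => by
          obtain ⟨h1, h4⟩ := hf.mem_Ioo (B (terminalDate T) ω)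
          rw [Real.norm_of_nonneg (by linarith)]
          exact h4.le)
    -- The endowments average to (1 + γ)/2 and (3 + 4 - γ)/2 = 4 - (1 + γ)/2.
    have h := isWalrasianEquilibrium_iff (P := P) hu (sum_endowment B f)
      (c := ![(1 + γ) / 2, 4 - (1 + γ) / 2])
      (Fin.forall_fin_two.2 ⟨by simp; linarith, by simp; linarith⟩)
      (Fin.forall_fin_two.2 ⟨by simp [meanConsumption, endowment, hγdef], by
        simp only [meanConsumption, endowment, Matrix.cons_val_one, Matrix.cons_val_fin_one]
        rw [integral_sub (integrable_const _) hint]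
        simp only [integral_const, probReal_univ, one_smul]
        ring⟩)
      (by simp) p x
    rw [h, Fin.forall_fin_two]
    rfl
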